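/- Let $A = \mathbb{R}[X,Y,Z]/(X^2+Y^2+Z^2-1)$, and let $x, y, z \in A$ be the residue classes of $X, Y, Z$. Let $E_3(A)$ be the subgroup of $SL_3(A)$ generated by the matrices $e_{ij}(\lambda)$ ($i \neq j$, $\lambda \in A$) that have $1$ in every diagonal entry, $\lambda$ in the $(i,j)$ entry, and $0$ elsewhere. Then: 1. The row $(x,y,z) \in A^3$ is unimodular, that is, there are $b_1,b_2,b_3 \in A$ with $xb_1+yb_2+zb_3=1$. 2. The row $(x,y,z)$ is not completable: no matrix in $GL_3(A)$ has first row $(x,y,z)$. 3. In particular, no matrix in $E_3(A)$ has first row $(x,y,z)$, and $(x,y,z)$ is not $E_3(A)$-equivalent to $(1,0,0)$: there is no $\sigma \in E_3(A)$ with $(x,y,z)\,\sigma = (1,0,0)$. -/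

import Mathlib

namespace UnimodularRows

/-- A row `a` over `A` is unimodular if `∑ i, a i * b i = 1` for some row `b`. -/
def IsUnimodular {A : Type*} [CommRing A] {n : ℕ} (a : Fin n → A) : Prop :=
  ∃ b : Fin n → A, ∑ i, a i * b i = 1

/-- `E_n(A)`: the subgroup of `SL_n(A)` generated by the matrices `e_{ij}(c) = 1 + c E_{ij}`
with `i ≠ j` and `c ∈ A`. -/
def elementaryGroup (n : ℕ) (A : Type*) [CommRing A] :
    Subgroup (Matrix.SpecialLinearGroup (Fin n) A) :=
  Subgroup.closure
    {g | ∃ (i j : Fin n) (c : A), i ≠ j ∧ (g : Matrix (Fin n) (Fin n) A) = Matrix.transvection i j c}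

/-- The row `a` is the first row of a matrix in `GL_n(A)`. -/
def IsCompletable {A : Type*} [CommRing A] {n : ℕ} [NeZero n] (a : Fin n → A) : Prop :=
  ∃ M : GL (Fin n) A, (M : Matrix (Fin n) (Fin n) A).row 0 = a

/-- The row `a` is the first row of a matrix in `E_n(A)`. -/
def IsElementaryCompletable {A : Type*} [CommRing A] {n : ℕ} [NeZero n] (a : Fin n → A) : Prop :=
  ∃ M ∈ elementaryGroup n A, (M : Matrix (Fin n) (Fin n) A).row 0 = a

/-- The rows `a` and `b` are equivalent under right multiplication by matrices in `E_n(A)`. -/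
def ElementaryEquiv {A : Type*} [CommRing A] {n : ℕ} (a b : Fin n → A) : Prop :=
  ∃ M ∈ elementaryGroup n A, Matrix.vecMul a (M : Matrix (Fin n) (Fin n) A) = b

/-- The ideal `(X² + Y² + Z² - 1)` of `ℝ[X, Y, Z]`. -/
noncomputable def sphereIdeal : Ideal (MvPolynomial (Fin 3) ℝ) :=
  Ideal.span {MvPolynomial.X 0 ^ 2 + MvPolynomial.X 1 ^ 2 + MvPolynomial.X 2 ^ 2 - 1}

/-- `ℝ[X, Y, Z] / (X² + Y² + Z² - 1)`. -/
abbrev SphereRing : Type := MvPolynomial (Fin 3) ℝ ⧸ sphereIdeal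

/-- The row `(x, y, z)` of the residue classes of `X`, `Y`, `Z`. -/
noncomputable def sphereRow : Fin 3 → SphereRing :=
  ![Ideal.Quotient.mk sphereIdeal (MvPolynomial.X 0),
    Ideal.Quotient.mk sphereIdeal (MvPolynomial.X 1),
    Ideal.Quotient.mk sphereIdeal (MvPolynomial.X 2)]

end UnimodularRows

/-! Evaluated at points of the sphere, the second row of a completion is a continuous vector field.
Its tangential part vanishes at some `p` by the hairy ball theorem; there the first two rows are
proportional, so an invertible determinant would evaluate to zero.

For hairy ball, push a nowhere zero tangent field to the plane from both poles. Each image is a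
nonvanishing function on `ℂ`, hence has a continuous logarithm; but on the equator their product is
a negative multiple of `w ^ 2`, which has winding number two. -/

open Complex in
/-- A nowhere vanishing continuous function on the plane has a continuous logarithm. -/
theorem exists_continuous_log {g : ℂ → ℂ} (hg : Continuous g) (h0 : ∀ z, g z ≠ 0) :
    ∃ L : ℂ → ℂ, Continuous L ∧ ∀ z, exp (L z) = g z := by
  obtain ⟨F, ⟨-, hF⟩, -⟩ := isCoveringMapOn_exp.existsUnique_continuousMap_lifts
    (⟨g, hg⟩ : C(ℂ, ℂ)) (a₀ := 0) (e₀ := log (g 0)) (exp_log (h0 0)) h0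
  exact ⟨F, F.continuous, fun z => congrFun hF z⟩

open Complex in
/-- A continuous function on the line on whose values `exp` is constant is itself constant. -/
theorem eq_of_exp_eq_const {K : ℝ → ℂ} (hK : Continuous K) {c : ℂ} (h : ∀ t, exp (K t) = c)
    (s t : ℝ) : K s = K t := by
  have := isCoveringMap_exp.eq_of_comp_eq hK (continuous_const (y := K t))
    (funext fun r => Subtype.ext ((h r).trans (h t).symm)) t rfl
  exact congrFun this s

open Complex in
/-- The squaring map of the unit circle has degree two, so no negative multiple of it
has a continuous logarithm. -/
theorem not_exp_eq_neg_mul_sq {L : ℂ → ℂ} (hL : Continuous L) {r : ℂ → ℝ}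
    (hr : ∀ z, ‖z‖ = 1 → 0 < r z) : ¬ ∀ z, ‖z‖ = 1 → exp (L z) = -(r z) * z ^ 2 := by
  intro h
  let e : ℝ → ℂ := fun t => exp (t * I)
  have he : Continuous e := by fun_prop
  -- Removing the modulus and the angle `2t` leaves a logarithm of `-1`, hence a constant, yet `K`
  -- drops by `4πi` over one turn.
  let K : ℝ → ℂ := fun t => L (e t) - (L (e t)).re - 2 * (t * I)
  have hK : Continuous K := by fun_prop
  have hexp : ∀ t, exp (K t) = -1 := by
    intro t
    have h1 : ‖e t‖ = 1 := norm_exp_ofReal_mul_I t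
    have h2 := h _ h1
    have h3 : Real.exp (L (e t)).re = r (e t) := by
      rw [← norm_exp, h2]
      simp [h1, abs_of_pos (hr _ h1)]
    have h4 : exp (2 * (t * I)) = e t ^ 2 := by rw [← exp_nat_mul]; norm_num
    have h5 : (r (e t) : ℂ) ≠ 0 := by exact_mod_cast (hr _ h1).ne'
    have h6 : e t ≠ 0 := exp_ne_zero _
    simp only [K]
    rw [exp_sub, exp_sub, h2, h4, ← ofReal_exp, h3]
    field_simp
  have hper : e (2 * Real.pi) = e 0 := by simp [e]
  have := eq_of_exp_eq_const hK hexp (2 * Real.pi) 0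
  simp [K, hper, Real.pi_ne_zero] at this

/-- Inverse stereographic projection from the pole `(0, 0, s)`, for `s = 1` or `s = -1`. -/
noncomputable def stereoInv (s : ℝ) (w : ℂ) : Fin 3 → ℝ :=
  ![2 * w.re / (1 + (w.re ^ 2 + w.im ^ 2)), 2 * w.im / (1 + (w.re ^ 2 + w.im ^ 2)),
    s * ((w.re ^ 2 + w.im ^ 2 - 1) / (1 + (w.re ^ 2 + w.im ^ 2)))]

theorem continuous_stereoInv (s : ℝ) : Continuous (stereoInv s) := by
  have h : ∀ w : ℂ, 1 + (w.re ^ 2 + w.im ^ 2) ≠ 0 := fun w => by positivity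
  refine continuous_pi fun i => ?_
  fin_cases i <;> simp [stereoInv] <;> fun_prop (disch := exact h _)

theorem stereoInv_mem {s : ℝ} (hs : s ^ 2 = 1) (w : ℂ) :
    stereoInv s w 0 ^ 2 + stereoInv s w 1 ^ 2 + stereoInv s w 2 ^ 2 = 1 := by
  have h : 1 + (w.re ^ 2 + w.im ^ 2) ≠ 0 := by positivity
  simp only [stereoInv, Matrix.cons_val, mul_pow, hs]
  field_simp
  ring

theorem one_sub_stereoInv_ne_zero {s : ℝ} (hs : s ^ 2 = 1) (w : ℂ) :
    1 - s * stereoInv s w 2 ≠ 0 := by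
  have h : 1 + (w.re ^ 2 + w.im ^ 2) ≠ 0 := by positivity
  have : 1 - s * stereoInv s w 2 = 2 / (1 + (w.re ^ 2 + w.im ^ 2)) := by
    simp only [stereoInv, Matrix.cons_val, ← mul_assoc, ← sq, hs]
    field_simp
    ring
  rw [this]
  positivity

theorem stereoInv_of_norm_eq_one (s : ℝ) {w : ℂ} (hw : ‖w‖ = 1) :
    stereoInv s w = ![w.re, w.im, 0] := by
  have h : w.re ^ 2 + w.im ^ 2 = 1 := by
    have := Complex.sq_norm w
    rw [hw, Complex.normSq_apply] at this
    linarith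
  norm_num [stereoInv, h]

/-- The differential at `p` of stereographic projection from `(0, 0, s)`, applied to `v` and scaled
by `(1 - s * p 2) ^ 2`. -/
noncomputable def stereoDeriv (s : ℝ) (p v : Fin 3 → ℝ) : ℂ :=
  ⟨(1 - s * p 2) * v 0 + s * p 0 * v 2, (1 - s * p 2) * v 1 + s * p 1 * v 2⟩

theorem continuous_stereoDeriv (s : ℝ) :
    Continuous fun x : (Fin 3 → ℝ) × (Fin 3 → ℝ) => stereoDeriv s x.1 x.2 := by
  simp only [stereoDeriv, Complex.mk_eq_add_mul_I]
  fun_prop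

/-- Stereographic projection is conformal, so a nonzero tangent vector has nonzero image away from
the pole. -/
theorem normSq_stereoDeriv {s : ℝ} (hs : s ^ 2 = 1) {p v : Fin 3 → ℝ}
    (hp : p 0 ^ 2 + p 1 ^ 2 + p 2 ^ 2 = 1) (hv : p 0 * v 0 + p 1 * v 1 + p 2 * v 2 = 0) :
    Complex.normSq (stereoDeriv s p v) =
      (1 - s * p 2) ^ 2 * (v 0 ^ 2 + v 1 ^ 2 + v 2 ^ 2) := by
  rw [Complex.normSq_apply]
  simp only [stereoDeriv]
  linear_combination 2 * s * (1 - s * p 2) * v 2 * hv + s ^ 2 * v 2 ^ 2 * hp + v 2 ^ 2 * hs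

/-- With `v = (t * I * w, v 2)`, the two factors are `w * (t * I + v 2)` and `w * (t * I - v 2)`. -/
theorem stereoDeriv_mul_stereoDeriv {w : ℂ} (hw : ‖w‖ = 1) {v : Fin 3 → ℝ}
    (hv : w.re * v 0 + w.im * v 1 = 0) :
    stereoDeriv 1 ![w.re, w.im, 0] v * stereoDeriv (-1) ![w.re, w.im, 0] v =
      -((v 0 ^ 2 + v 1 ^ 2 + v 2 ^ 2 : ℝ) : ℂ) * w ^ 2 := by
  have h : w.re ^ 2 + w.im ^ 2 = 1 := by
    have := Complex.sq_norm w
    rw [hw, Complex.normSq_apply] at this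
    linarith
  obtain ⟨t, h0, h1⟩ : ∃ t, v 0 = -t * w.im ∧ v 1 = t * w.re :=
    ⟨v 1 * w.re - v 0 * w.im, by linear_combination -v 0 * h + w.re * hv,
      by linear_combination -v 1 * h + w.im * hv⟩
  apply Complex.ext <;>
    simp only [stereoDeriv, Matrix.cons_val, Complex.mul_re, Complex.mul_im, Complex.neg_re,
      Complex.neg_im, Complex.ofReal_re, Complex.ofReal_im, sq, h0, h1]
  · linear_combination t ^ 2 * (w.re ^ 2 - w.im ^ 2) * h
  · linear_combination 2 * t ^ 2 * w.re * w.im * h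

/-- The hairy ball theorem: a continuous tangent vector field on the two-sphere has a zero. -/
theorem exists_zero_of_tangent {v : (Fin 3 → ℝ) → Fin 3 → ℝ}
    (hv : ContinuousOn v {p | p 0 ^ 2 + p 1 ^ 2 + p 2 ^ 2 = 1})
    (ht : ∀ p, p 0 ^ 2 + p 1 ^ 2 + p 2 ^ 2 = 1 → p 0 * v p 0 + p 1 * v p 1 + p 2 * v p 2 = 0) :
    ∃ p, p 0 ^ 2 + p 1 ^ 2 + p 2 ^ 2 = 1 ∧ v p = 0 := by
  by_contra! hne
  have hpos : ∀ p, p 0 ^ 2 + p 1 ^ 2 + p 2 ^ 2 = 1 → 0 < v p 0 ^ 2 + v p 1 ^ 2 + v p 2 ^ 2 := by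
    intro p hp
    refine lt_of_le_of_ne (by positivity) fun h => hne p hp ?_
    ext i
    fin_cases i <;> simp <;> nlinarith [sq_nonneg (v p 0), sq_nonneg (v p 1), sq_nonneg (v p 2)]
  have hlog : ∀ s : ℝ, s ^ 2 = 1 → ∃ L : ℂ → ℂ, Continuous L ∧
      ∀ w, Complex.exp (L w) = stereoDeriv s (stereoInv s w) (v (stereoInv s w)) := by
    intro s hs
    apply exists_continuous_log
    · exact (continuous_stereoDeriv s).comp ((continuous_stereoInv s).prodMk
        (hv.comp_continuous (continuous_stereoInv s) (stereoInv_mem hs)))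
    · intro w
      have hp := stereoInv_mem hs w
      rw [← Complex.normSq_pos, normSq_stereoDeriv hs hp (ht _ hp)]
      have := one_sub_stereoInv_ne_zero hs w
      have := hpos _ hp
      positivity
  obtain ⟨L₁, hL₁, h₁⟩ := hlog 1 (by norm_num)
  obtain ⟨L₂, hL₂, h₂⟩ := hlog (-1) (by norm_num)
  have heq : ∀ w : ℂ, ‖w‖ = 1 → w.re ^ 2 + w.im ^ 2 + 0 ^ 2 = 1 := by
    intro w hw
    have := Complex.sq_norm w
    rw [hw, Complex.normSq_apply] at this
    linarith
  -- Both charts restrict to the identity on the equator, so `L₁ + L₂` is a logarithm of the product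
  -- there.
  refine not_exp_eq_neg_mul_sq (hL₁.add hL₂)
    (r := fun w => v ![w.re, w.im, 0] 0 ^ 2 + v ![w.re, w.im, 0] 1 ^ 2 + v ![w.re, w.im, 0] 2 ^ 2)
    (fun w hw => hpos _ (heq w hw)) fun w hw => ?_
  rw [Pi.add_apply, Complex.exp_add, h₁, h₂, stereoInv_of_norm_eq_one _ hw, stereoInv_of_norm_eq_one _ hw]
  refine stereoDeriv_mul_stereoDeriv hw ?_
  simpa using ht ![w.re, w.im, 0] (heq w hw)

namespace UnimodularRows

/-- Evaluation of the elements of the coordinate ring at a point of the sphere. -/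
noncomputable def sphereEval (p : Fin 3 → ℝ) (hp : p 0 ^ 2 + p 1 ^ 2 + p 2 ^ 2 = 1) :
    SphereRing →+* ℝ :=
  Ideal.Quotient.lift sphereIdeal (MvPolynomial.eval p) fun a ha => by
    have : sphereIdeal ≤ RingHom.ker (MvPolynomial.eval p) := by
      rw [sphereIdeal, Ideal.span_singleton_le_iff_mem, RingHom.mem_ker]
      simp [hp]
    exact this ha

@[simp]
theorem sphereEval_mk (p : Fin 3 → ℝ) (hp : p 0 ^ 2 + p 1 ^ 2 + p 2 ^ 2 = 1)
    (q : MvPolynomial (Fin 3) ℝ) :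
    sphereEval p hp (Ideal.Quotient.mk sphereIdeal q) = MvPolynomial.eval p q :=
  rfl

theorem sphereEval_sphereRow (p : Fin 3 → ℝ) (hp : p 0 ^ 2 + p 1 ^ 2 + p 2 ^ 2 = 1) (i : Fin 3) :
    sphereEval p hp (sphereRow i) = p i := by
  fin_cases i <;> simp [sphereRow]

theorem isUnimodular_sphereRow : IsUnimodular sphereRow := by
  refine ⟨sphereRow, ?_⟩
  have : Ideal.Quotient.mk sphereIdeal (MvPolynomial.X 0 ^ 2 + MvPolynomial.X 1 ^ 2 +
      MvPolynomial.X 2 ^ 2 - 1) = 0 :=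
    Ideal.Quotient.eq_zero_iff_mem.mpr (Ideal.mem_span_singleton_self _)
  rw [map_sub, map_one, sub_eq_zero] at this
  simpa [Fin.sum_univ_three, sphereRow, sq] using this

theorem not_isCompletable_sphereRow : ¬ IsCompletable sphereRow := by
  rintro ⟨M, hM⟩
  have hM0 : ∀ j, (M : Matrix (Fin 3) (Fin 3) SphereRing) 0 j = sphereRow j := congrFun hM
  -- Polynomial representatives extend the second row continuously to all of `ℝ³`.
  choose q hq using fun j => Ideal.Quotient.mk_surjective
    ((M : Matrix (Fin 3) (Fin 3) SphereRing) 1 j)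
  let n : (Fin 3 → ℝ) → Fin 3 → ℝ := fun p j => MvPolynomial.eval p (q j)
  have hn : Continuous n := continuous_pi fun j => MvPolynomial.continuous_eval (q j)
  let d : (Fin 3 → ℝ) → ℝ := fun p => p 0 * n p 0 + p 1 * n p 1 + p 2 * n p 2
  have hd : Continuous d := by fun_prop
  obtain ⟨p, hp, hv⟩ := exists_zero_of_tangent (v := fun p => n p - d p • p)
    (by fun_prop) (fun p hp => by
      simp only [Pi.sub_apply, Pi.smul_apply, smul_eq_mul, d]
      linear_combination -(p 0 * n p 0 + p 1 * n p 1 + p 2 * n p 2) * hp)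
  rw [sub_eq_zero] at hv
  let N : Matrix (Fin 3) (Fin 3) ℝ :=
    (M : Matrix (Fin 3) (Fin 3) SphereRing).map (sphereEval p hp)
  have hN0 : ∀ j, N 0 j = p j := fun j => by simp [N, hM0, sphereEval_sphereRow]
  have hN1 : ∀ j, N 1 j = d p * p j := fun j => by
    have := congrFun hv j
    simpa [N, ← hq, n] using this
  have hdet : IsUnit N.det := by
    have h := ((Matrix.isUnit_iff_isUnit_det _).mp M.isUnit).map (sphereEval p hp)
    rwa [RingHom.map_det] at h
  refine hdet.ne_zero ?_
  rw [Matrix.det_fin_three]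
  simp only [hN0, hN1]
  ring

theorem IsElementaryCompletable.isCompletable {A : Type*} [CommRing A] {n : ℕ} [NeZero n]
    {a : Fin n → A} (h : IsElementaryCompletable a) : IsCompletable a :=
  let ⟨M, _, hM⟩ := h
  ⟨(M : GL (Fin n) A), hM⟩

/-- If `a M` is the first basis row, then `a` is the first row of `M⁻¹`. -/
theorem ElementaryEquiv.isElementaryCompletable {A : Type*} [CommRing A] {n : ℕ} [NeZero n]
    {a : Fin n → A} (h : ElementaryEquiv a (Pi.single 0 1)) : IsElementaryCompletable a := by
  obtain ⟨M, hM, h⟩ := h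
  refine ⟨M⁻¹, inv_mem hM, ?_⟩
  have h1 : (M : Matrix (Fin n) (Fin n) A) * (M⁻¹ : Matrix.SpecialLinearGroup (Fin n) A) = 1 := by
    rw [← Matrix.SpecialLinearGroup.coe_mul, mul_inv_cancel, Matrix.SpecialLinearGroup.coe_one]
  rw [← Matrix.single_one_vecMul, ← h, Matrix.vecMul_vecMul, h1, Matrix.vecMul_one]

end UnimodularRows

theorem mainTheorem4 :
    UnimodularRows.IsUnimodular UnimodularRows.sphereRow ∧
    ¬ UnimodularRows.IsCompletable UnimodularRows.sphereRow ∧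
    ¬ UnimodularRows.IsElementaryCompletable UnimodularRows.sphereRow ∧
    ¬ UnimodularRows.ElementaryEquiv UnimodularRows.sphereRow ![1, 0, 0] := by
  refine ⟨UnimodularRows.isUnimodular_sphereRow, UnimodularRows.not_isCompletable_sphereRow,
    fun h => UnimodularRows.not_isCompletable_sphereRow h.isCompletable, fun h => ?_⟩
  have h1 : (![1, 0, 0] : Fin 3 → UnimodularRows.SphereRing) = Pi.single 0 1 := by
    ext i
    fin_cases i <;> rfl
  rw [h1] at h
  exact UnimodularRows.not_isCompletable_sphereRow h.isElementaryCompletable.isCompletable
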